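/- Theorem 2. For a commutative ring $R$ with identity let $\mathrm{GL}(R)=\bigcup_n \mathrm{GL}_n(R)$, where $\mathrm{GL}_n(R)\subset \mathrm{GL}_{n+1}(R)$ via $\alpha\mapsto\begin{pmatrix}\alpha&0\\0&1\end{pmatrix}$, let $\mathrm{E}(R)=\bigcup_n\mathrm{E}_n(R)$, where $\mathrm{E}_n(R)$ is the subgroup of $\mathrm{GL}_n(R)$ generated by the elementary matrices $I+\lambda e_{ij}$ ($\lambda\in R$, $i\neq j$), let $\mathrm{K}_1(R)=\mathrm{GL}(R)/\mathrm{E}(R)$, write $[\alpha]$ for the class of $\alpha\in \mathrm{GL}_n(R)$, and let $\mathrm{SK}_1(R)$ be the kernel of $\det:\mathrm{K}_1(R)\to R^{*}$. Let $R=R_0\oplus R_1\oplus R_2\oplus\cdots$ be a graded commutative ring with identity, and let $k\in\mathbb{N}$ be such that $k$ is a unit in $R_0$. (1) Let $N=N_0+N_1+\cdots+N_r$ be a nilpotent $n\times n$ matrix over $R$ (of arbitrary size $n$ and with arbitrary $r$), where $N_i$ has all its entries in $R_i$. If $[I+N]^k=[I]$, then $[I+N]\in\mathrm{SK}_1(R)$,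 the matrix $I+N_0$ is invertible, and $[I+N]=[I+N_0]$ in $\mathrm{SK}_1(R)$. (2) In particular, if $R_0$ is a reduced local ring, then $\mathrm{SK}_1(R)$ has no $k$-torsion: if $x\in\mathrm{SK}_1(R)$ and $x^k=1$, then $x=1$. -/

import Mathlib

/-! ### Stable linear groups and `K₁` -/

namespace AlgebraicK

open Matrix

universe u

section Ring

variable {R : Type u} [Ring R]

/-- The stabilisation `M ⊥ I_{m-n}` (for `n ≤ m`) of an `n × n` matrix `M`: the `m × m` matrix with
`M` in the upper left corner, ones on the rest of the diagonal and zeros elsewhere. -/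
def stabMatrix {n : ℕ} (m : ℕ) (M : Matrix (Fin n) (Fin n) R) : Matrix (Fin m) (Fin m) R :=
  Matrix.of fun i j =>
    if h : (i : ℕ) < n ∧ (j : ℕ) < n then M ⟨i, h.1⟩ ⟨j, h.2⟩ else if i = j then 1 else 0

theorem stabMatrix_one (n m : ℕ) : stabMatrix m (1 : Matrix (Fin n) (Fin n) R) = 1 := by
  ext i j
  by_cases h : (i : ℕ) < n ∧ (j : ℕ) < n
  · simp [stabMatrix, Matrix.one_apply, Fin.ext_iff]
  · simp [stabMatrix, h, Matrix.one_apply]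

theorem stabMatrix_self {n : ℕ} (M : Matrix (Fin n) (Fin n) R) : stabMatrix n M = M := by
  ext i j
  simp [stabMatrix]

theorem stabMatrix_stabMatrix {l n m : ℕ} (h : l ≤ n)
    (M : Matrix (Fin l) (Fin l) R) : stabMatrix m (stabMatrix n M) = stabMatrix m M := by
  ext i j
  simp only [stabMatrix, Matrix.of_apply]
  split_ifs <;> first | rfl | (simp_all [Fin.ext_iff]; done) | (exfalso; simp_all [Fin.ext_iff]; omega)

theorem stabMatrix_add_eq {n t : ℕ} (M : Matrix (Fin n) (Fin n) R) :
    stabMatrix (n + t) M =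
      (Matrix.fromBlocks M 0 0 (1 : Matrix (Fin t) (Fin t) R)).submatrix
        finSumFinEquiv.symm finSumFinEquiv.symm := by
  ext i j
  refine Fin.addCases (fun i => ?_) (fun i => ?_) i <;>
    refine Fin.addCases (fun j => ?_) (fun j => ?_) j
  · simp [stabMatrix]
  · simp [stabMatrix, Fin.ext_iff]; omega
  · simp [stabMatrix, Fin.ext_iff]; omega
  · simp [stabMatrix, Matrix.one_apply, Fin.ext_iff]

theorem stabMatrix_mul {n m : ℕ} (h : n ≤ m) (M N : Matrix (Fin n) (Fin n) R) :
    stabMatrix m (M * N) = stabMatrix m M * stabMatrix m N := by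
  obtain ⟨t, rfl⟩ := Nat.exists_eq_add_of_le h
  rw [stabMatrix_add_eq, stabMatrix_add_eq, stabMatrix_add_eq, Matrix.submatrix_mul_equiv,
    Matrix.fromBlocks_multiply]
  simp

/-- The embedding `GL_n(R) → GL_m(R)`, `α ↦ α ⊥ I_{m-n}`, for `n ≤ m`. -/
def stabHom {n m : ℕ} (h : n ≤ m) : GL (Fin n) R →* GL (Fin m) R :=
  Units.map
    { toFun := stabMatrix m
      map_one' := stabMatrix_one n m
      map_mul' := stabMatrix_mul h }

theorem coe_stabHom {n m : ℕ} (h : n ≤ m) (g : GL (Fin n) R) :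
    ((stabHom h g : GL (Fin m) R) : Matrix (Fin m) (Fin m) R) =
      stabMatrix m (g : Matrix (Fin n) (Fin n) R) := rfl

instance directedSystem_stabHom :
    DirectedSystem (fun n : ℕ => GL (Fin n) R) (fun _ _ h => stabHom h) where
  map_self _ g := Units.ext (stabMatrix_self g.val)
  map_map _ _ _ h _ g := Units.ext (stabMatrix_stabMatrix h g.val)

variable (R) in
/-- The infinite general linear group `GL(R) = ⋃ GL_n(R)`. -/
abbrev StableGL : Type u :=
  DirectLimit (fun n : ℕ => GL (Fin n) R) (fun _ _ h => stabHom h)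

/-- The inclusion `GL_n(R) → GL(R)`. -/
def toStableGL (n : ℕ) : GL (Fin n) R →* StableGL R where
  toFun g := ⟦⟨n, g⟩⟧
  map_one' := (DirectLimit.one_def n).symm
  map_mul' g h := (DirectLimit.mul_def (f := fun _ _ h => stabHom h) n g h).symm

theorem toStableGL_stabHom {n m : ℕ} (h : n ≤ m) (g : GL (Fin n) R) :
    toStableGL m (stabHom h g) = toStableGL n g := by
  change (⟦⟨m, stabHom h g⟩⟧ : StableGL R) = ⟦⟨n, g⟩⟧
  exact DirectLimit.mk_apply (F := fun n : ℕ => GL (Fin n) R) (f := fun _ _ h => stabHom h) n m g h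

variable (R) in
/-- The group `E_n(R)` generated by the elementary matrices `I + c e_{ij}`, `i ≠ j`. -/
def elementaryGroup (n : ℕ) : Subgroup (GL (Fin n) R) :=
  Subgroup.closure
    {g | ∃ (i j : Fin n) (c : R), i ≠ j ∧
      (g : Matrix (Fin n) (Fin n) R) = 1 + Matrix.single i j c}

theorem mem_elementaryGroup_of_eq {n : ℕ} {i j : Fin n} (hij : i ≠ j) (c : R) (g : GL (Fin n) R)
    (hg : (g : Matrix (Fin n) (Fin n) R) = 1 + Matrix.single i j c) : g ∈ elementaryGroup R n :=
  Subgroup.subset_closure ⟨i, j, c, hij, hg⟩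

theorem stabMatrix_elementary {n m : ℕ} (h : n ≤ m) (i j : Fin n) (c : R) :
    stabMatrix m (1 + Matrix.single i j c) =
      1 + Matrix.single (Fin.castLE h i) (Fin.castLE h j) c := by
  ext a b
  by_cases hab : (a : ℕ) < n ∧ (b : ℕ) < n
  · simp [stabMatrix, hab, Matrix.one_apply, Matrix.single_apply, Fin.ext_iff]
  · have : ¬ ((i : ℕ) = a ∧ (j : ℕ) = b) := by
      rintro ⟨h1, h2⟩
      exact hab ⟨h1 ▸ i.2, h2 ▸ j.2⟩
    simp [stabMatrix, hab, Matrix.one_apply, Matrix.single_apply, Fin.ext_iff, this]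

theorem stabHom_mem_elementaryGroup {n m : ℕ} (h : n ≤ m) {g : GL (Fin n) R}
    (hg : g ∈ elementaryGroup R n) : stabHom h g ∈ elementaryGroup R m := by
  suffices elementaryGroup R n ≤ (elementaryGroup R m).comap (stabHom h) from this hg
  refine (Subgroup.closure_le _).2 ?_
  rintro g ⟨i, j, c, hij, hg⟩
  refine mem_elementaryGroup_of_eq (i := Fin.castLE h i) (j := Fin.castLE h j)
    (fun e => hij (Fin.castLE_injective h e)) c _ ?_
  rw [coe_stabHom, hg, stabMatrix_elementary]

variable (R) in
/-- The infinite elementary group `E(R) = ⋃ E_n(R)`. -/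
def stableElementaryGroup : Subgroup (StableGL R) where
  carrier := {x | ∃ (n : ℕ) (g : GL (Fin n) R), g ∈ elementaryGroup R n ∧ toStableGL n g = x}
  one_mem' := ⟨0, 1, one_mem _, map_one _⟩
  mul_mem' := by
    rintro _ _ ⟨n, g, hg, rfl⟩ ⟨m, h, hh, rfl⟩
    refine ⟨max n m, stabHom (le_max_left n m) g * stabHom (le_max_right n m) h,
      mul_mem (stabHom_mem_elementaryGroup _ hg) (stabHom_mem_elementaryGroup _ hh), ?_⟩
    rw [map_mul, toStableGL_stabHom, toStableGL_stabHom]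
  inv_mem' := by
    rintro _ ⟨n, g, hg, rfl⟩
    exact ⟨n, g⁻¹, inv_mem hg, map_inv _ _⟩

/-! Normality of `E(R)` in `GL(R)`. -/

theorem exists_unit_of_mul_self {n : ℕ} (X : Matrix (Fin n) (Fin n) R) (hX : X * X = 0) :
    ∃ g : GL (Fin n) R, g.val = 1 + X :=
  ⟨⟨1 + X, 1 - X, by simp [add_mul, mul_sub, hX], by simp [sub_mul, mul_add, hX]⟩, rfl⟩

theorem single_eq_vecMulVec {n : ℕ} (i j : Fin n) (c : R) :
    Matrix.single i j c = Matrix.vecMulVec (Pi.single i c) (Pi.single j 1) := by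
  ext a b
  by_cases ha : i = a <;> by_cases hb : j = b <;>
    simp [Matrix.vecMulVec_apply, ha, hb]

theorem exists_mem_column {n : ℕ} (p : Fin n) (u : Fin n → R) (hu : u p = 0) :
    ∃ g ∈ elementaryGroup R n, g.val = 1 + Matrix.vecMulVec u (Pi.single p 1) := by
  suffices ∀ s : Finset (Fin n), ∃ g ∈ elementaryGroup R n,
      g.val = 1 + Matrix.vecMulVec (∑ i ∈ s, Pi.single i (u i)) (Pi.single p 1) by
    simpa [Finset.univ_sum_single] using this Finset.univ
  intro s
  induction s using Finset.induction_on with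
  | empty => exact ⟨1, one_mem _, by simp⟩
  | insert i s hi ih =>
    obtain ⟨g, hg, hgv⟩ := ih
    by_cases hip : i = p
    · refine ⟨g, hg, ?_⟩
      rw [Finset.sum_insert hi, hip, hu, Pi.single_zero, zero_add, hgv]
    · obtain ⟨e, he⟩ := exists_unit_of_mul_self (Matrix.single i p (u i))
        (Matrix.single_mul_single_of_ne _ _ _ _ (Ne.symm hip) _)
      refine ⟨g * e, mul_mem hg (mem_elementaryGroup_of_eq hip _ e he), ?_⟩
      rw [Units.val_mul, hgv, he, Finset.sum_insert hi, single_eq_vecMulVec, add_mul, one_mul,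
        mul_add, mul_one, Matrix.vecMulVec_mul_vecMulVec, Matrix.add_vecMulVec]
      simp [hip]
      abel

theorem exists_mem_row {n : ℕ} (p : Fin n) (v : Fin n → R) (hv : v p = 0) :
    ∃ g ∈ elementaryGroup R n, g.val = 1 + Matrix.vecMulVec (Pi.single p 1) v := by
  suffices ∀ s : Finset (Fin n), ∃ g ∈ elementaryGroup R n,
      g.val = 1 + Matrix.vecMulVec (Pi.single p 1) (∑ i ∈ s, Pi.single i (v i)) by
    simpa [Finset.univ_sum_single] using this Finset.univ
  intro s
  induction s using Finset.induction_on with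
  | empty => exact ⟨1, one_mem _, by simp⟩
  | insert i s hi ih =>
    obtain ⟨g, hg, hgv⟩ := ih
    by_cases hip : i = p
    · refine ⟨g, hg, ?_⟩
      rw [Finset.sum_insert hi, hip, hv, Pi.single_zero, zero_add, hgv]
    · obtain ⟨e, he⟩ := exists_unit_of_mul_self (Matrix.single p i (v i))
        (Matrix.single_mul_single_of_ne _ _ _ _ hip _)
      have h1 : Matrix.single p i (v i) =
          Matrix.vecMulVec (Pi.single p 1) (Pi.single i (v i)) := by
        ext a b
        by_cases ha : p = a <;> by_cases hb : i = b <;>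
          simp [Matrix.vecMulVec_apply, ha, hb]
      refine ⟨e * g, mul_mem (mem_elementaryGroup_of_eq (Ne.symm hip) _ e he) hg, ?_⟩
      rw [Units.val_mul, hgv, he, Finset.sum_insert hi, h1, add_mul, one_mul,
        mul_add, mul_one, Matrix.vecMulVec_mul_vecMulVec, Matrix.vecMulVec_add]
      simp [hip]
      abel

/-- A matrix `I + u vᵀ` with `vᵀ u = 0` is elementary if `u` and `v` have a common zero
coordinate. -/
theorem mem_elementaryGroup_rankOne {n : ℕ} (p : Fin n) (u v : Fin n → R) (hu : u p = 0)
    (hv : v p = 0) (huv : v ⬝ᵥ u = 0) (g : GL (Fin n) R)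
    (hg : g.val = 1 + Matrix.vecMulVec u v) :
    g ∈ elementaryGroup R n := by
  obtain ⟨a, ha, hav⟩ := exists_mem_column p u hu
  obtain ⟨b, hb, hbv⟩ := exists_mem_row p v hv
  have key : g = a * b * (b * a)⁻¹ := by
    rw [eq_mul_inv_iff_mul_eq]
    refine Units.ext ?_
    simp only [Units.val_mul, hg, hav, hbv, add_mul, mul_add, one_mul, mul_one,
      Matrix.vecMulVec_mul_vecMulVec]
    simp [hv, huv]
    abel
  rw [key]
  exact mul_mem (mul_mem ha hb) (inv_mem (mul_mem hb ha))

theorem conj_stabHom_mem {n : ℕ} (a e : GL (Fin n) R) (he : e ∈ elementaryGroup R n) :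
    stabHom n.le_succ (a * e * a⁻¹) ∈ elementaryGroup R (n + 1) := by
  suffices elementaryGroup R n ≤ (elementaryGroup R (n + 1)).comap
      ((stabHom n.le_succ).comp (MulAut.conj a).toMonoidHom) from this he
  refine (Subgroup.closure_le _).2 ?_
  rintro e ⟨i, j, c, hij, he⟩
  change stabHom n.le_succ (a * e * a⁻¹) ∈ elementaryGroup R (n + 1)
  let A := stabHom n.le_succ a
  have hA : A⁻¹.val * A.val = 1 := A.inv_mul
  have hA' : A.val * A⁻¹.val = 1 := A.mul_inv
  have hB : A⁻¹.val = stabMatrix (n + 1) a⁻¹.val := by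
    change (stabHom n.le_succ a)⁻¹.val = _
    rw [← map_inv, coe_stabHom]
  refine mem_elementaryGroup_rankOne (Fin.last n)
    (A.val *ᵥ Pi.single i.castSucc c) (Pi.single j.castSucc 1 ᵥ* A⁻¹.val) ?_ ?_ ?_ _ ?_
  · rw [Matrix.mulVec_single]
    have := i.2.ne'
    simp [A, coe_stabHom, stabMatrix, Fin.ext_iff, this]
  · rw [Matrix.single_one_vecMul, hB]
    have := j.2.ne
    simp [stabMatrix, Fin.ext_iff, this]
  · rw [← Matrix.dotProduct_mulVec, Matrix.mulVec_mulVec, hA]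
    simp [hij.symm]
  · rw [map_mul, map_mul, map_inv]
    change A.val * (stabHom n.le_succ e).val * A⁻¹.val = _
    have hE : (stabHom n.le_succ e).val =
        1 + Matrix.vecMulVec (Pi.single i.castSucc c) (Pi.single j.castSucc 1) := by
      rw [coe_stabHom, he, stabMatrix_elementary n.le_succ, single_eq_vecMulVec]
      rfl
    rw [hE, mul_add, add_mul, mul_one, hA', Matrix.mul_vecMulVec, Matrix.vecMulVec_mul]

instance normal_stableElementaryGroup : (stableElementaryGroup R).Normal where
  conj_mem := by
    rintro _ ⟨n, e, he, rfl⟩ y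
    obtain ⟨m, a, rfl⟩ : ∃ m a, y = toStableGL m a := DirectLimit.exists_eq_mk _ y
    refine ⟨max n m + 1, stabHom (Nat.le_succ _)
      (stabHom (le_max_right n m) a * stabHom (le_max_left n m) e *
        (stabHom (le_max_right n m) a)⁻¹),
      conj_stabHom_mem _ _ (stabHom_mem_elementaryGroup _ he), ?_⟩
    rw [toStableGL_stabHom, map_mul, map_mul, map_inv, toStableGL_stabHom, toStableGL_stabHom]

variable (R) in
/-- The Whitehead group `K₁(R) = GL(R) / E(R)`. -/
abbrev K1 : Type u := StableGL R ⧸ stableElementaryGroup R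

/-- The class `[α] ∈ K₁(R)` of a matrix `α ∈ GL_n(R)`. -/
noncomputable def K1.of {n : ℕ} (g : GL (Fin n) R) : K1 R := QuotientGroup.mk (toStableGL n g)

/-- The class `[A] ∈ K₁(R)` of an invertible `n × n` matrix `A`. -/
noncomputable def K1.ofMatrix {n : ℕ} (A : Matrix (Fin n) (Fin n) R) (hA : IsUnit A) : K1 R :=
  K1.of hA.unit

end Ring

section CommRing

variable (R : Type u) [CommRing R]

variable {R} in
theorem det_stabMatrix {n m : ℕ} (h : n ≤ m) (M : Matrix (Fin n) (Fin n) R) :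
    (stabMatrix m M).det = M.det := by
  obtain ⟨t, rfl⟩ := Nat.exists_eq_add_of_le h
  rw [stabMatrix_add_eq, Matrix.det_submatrix_equiv_self]
  simp

/-- The determinant `GL(R) → Rˣ`. -/
noncomputable def stableDet : StableGL R →* Rˣ where
  toFun := DirectLimit.lift _ (fun _ g => Matrix.GeneralLinearGroup.det g)
    (fun _ _ h g => Units.ext (det_stabMatrix h g.val).symm)
  map_one' := by
    rw [DirectLimit.one_def 0]
    exact map_one _
  map_mul' x y := by
    induction x, y using DirectLimit.induction₂ with
    | ih n g h =>
      rw [DirectLimit.mul_def]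
      exact map_mul _ g h

theorem stableElementaryGroup_le_ker_stableDet :
    stableElementaryGroup R ≤ (stableDet R).ker := by
  rintro _ ⟨n, g, hg, rfl⟩
  suffices elementaryGroup R n ≤ ((stableDet R).comp (toStableGL n)).ker from this hg
  refine (Subgroup.closure_le _).2 ?_
  rintro g ⟨i, j, c, hij, hg⟩
  refine Units.ext ?_
  change (g : Matrix (Fin n) (Fin n) R).det = 1
  rw [hg]
  exact Matrix.det_transvection_of_ne i j hij c

/-- The determinant `K₁(R) → Rˣ`. -/
noncomputable def K1.det : K1 R →* Rˣ :=
  QuotientGroup.lift (stableElementaryGroup R) (stableDet R)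
    (fun _ hx => stableElementaryGroup_le_ker_stableDet R hx)

theorem K1.det_of {n : ℕ} (g : GL (Fin n) R) :
    K1.det R (K1.of g) = Matrix.GeneralLinearGroup.det g := rfl

/-- `SK₁(R)`, the kernel of the determinant `K₁(R) → Rˣ`. -/
noncomputable def SK1 : Subgroup (K1 R) := (K1.det R).ker

end CommRing

end AlgebraicK

/-! The core is that `NK₁(R)`, the kernel of `X = 0` on `K₁(R[X])`, has no `k`-torsion when `k` is a
unit (`K1.eq_one_of_map_eval_eq_one_of_pow_eq_one`). By Higman's trick (`exists_linearization`) an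
element of `NK₁(R)` is `x = [1 + Xν]`, and `ν` is nilpotent because `1 + Xν` is invertible over
`R[X]`. As `k` is a unit, `1 - X` has a `k`-th root `1 + X b` modulo any power of `X`. Put `U =
-Xν`; then `(1 + U b(U))^k = 1 - U = 1 + Xν`. A root of one representative is not enough: it must
depend homomorphically on `x`. Linearising `1 + X b` to `1 + X D` gives `[1 + U b(U)] = [1 - X D ⊗
ν]`, which is the image of `x` under the endomorphism `φ` of `K₁(R[X])` induced by `X ↦ -X D`, a
ring map into matrices over `R[X]` (`K1.lift`). So `x = φ(x)^k = φ(x^k)`, and `x^k = 1` forces `x =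
1`. For graded `R`, the ring map `r ↦ r Xⁱ` on degree `i` interpolates between the projection to
`R₀` (at `X = 0`) and the identity (at `X = 1`). Hence a `k`-torsion class of `K₁(R)` equals its
degree zero projection (`K1.map_projZero_eq_self`). This gives `[I + N] = [I + N₀]`. In the local
case the projection factors through `K₁(R₀)`, where determinant one implies triviality
(`K1.eq_one_of_det_eq_one`). -/

namespace AlgebraicK

open Matrix

/-! ### Whitehead lemma and arbitrary finite index sets -/

section GeneralIndex

universe u

variable {R : Type u} [CommRing R]
variable {ι κ : Type*} [Fintype ι] [DecidableEq ι] [Fintype κ] [DecidableEq κ]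

variable (R) in
/-- The homomorphism `GL_n(R) → K₁(R)`. -/
noncomputable def K1.ofHom (n : ℕ) : GL (Fin n) R →* K1 R :=
  (QuotientGroup.mk' (stableElementaryGroup R)).comp (toStableGL n)

variable (R) in
/-- The homomorphism `GL_ι(R) → K₁(R)` given by an enumeration of `ι`. -/
noncomputable def K1.ofEquiv {n : ℕ} (e : ι ≃ Fin n) : GL ι R →* K1 R :=
  (K1.ofHom R n).comp (Units.map (Matrix.reindexAlgEquiv R R e).toMonoidHom)

theorem K1.ofHom_eq_one {n : ℕ} {g : GL (Fin n) R} (hg : g ∈ elementaryGroup R n) :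
    K1.ofHom R n g = 1 :=
  (QuotientGroup.eq_one_iff _).2 ⟨n, g, hg, rfl⟩

theorem K1.ofHom_stabHom {n m : ℕ} (h : n ≤ m) (g : GL (Fin n) R) :
    K1.ofHom R m (stabHom h g) = K1.ofHom R n g := by
  simp [K1.ofHom, toStableGL_stabHom]

theorem K1.ofEquiv_elementary {n : ℕ} (e : ι ≃ Fin n) {i j : ι} (hij : i ≠ j) (c : R) (g : GL ι R)
    (hg : g.val = 1 + Matrix.single i j c) : K1.ofEquiv R e g = 1 := by
  refine K1.ofHom_eq_one (mem_elementaryGroup_of_eq (i := e i) (j := e j) (by simpa) c _ ?_)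
  change Matrix.reindexAlgEquiv R R e g.val = _
  rw [hg, map_add, map_one]
  congr 1
  ext a b
  simp [Matrix.single_apply, Equiv.eq_symm_apply]

/-- Matrix units with row in `s` and column outside `s` multiply to zero pairwise, so `1 + B` is the
product of the elementary matrices given by the entries of `B`. Block triangular matrices are the
main case. -/
theorem K1.ofEquiv_eq_one_of_support {n : ℕ} (e : ι ≃ Fin n) (s : Set ι) (B : Matrix ι ι R)
    (hB : ∀ a b, B a b ≠ 0 → a ∈ s ∧ b ∉ s) (g : GL ι R) (hg : g.val = 1 + B) :
    K1.ofEquiv R e g = 1 := by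
  suffices ∀ t : Finset (ι × ι), ∃ g : GL ι R, K1.ofEquiv R e g = 1 ∧
      g.val = 1 + ∑ p ∈ t, Matrix.single p.1 p.2 (B p.1 p.2) by
    obtain ⟨g', h1, h2⟩ := this Finset.univ
    have : g = g' := by
      refine Units.ext ?_
      rw [hg, h2, Fintype.sum_prod_type]
      exact congrArg (1 + ·) (Matrix.matrix_eq_sum_single B)
    rw [this, h1]
  intro t
  induction t using Finset.induction_on with
  | empty => exact ⟨1, map_one _, by simp⟩
  | insert p t hp ih =>
    obtain ⟨g, h1, h2⟩ := ih
    by_cases h0 : B p.1 p.2 = 0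
    · exact ⟨g, h1, by rw [Finset.sum_insert hp, h0, Matrix.single_zero, zero_add, h2]⟩
    have hps := hB _ _ h0
    have hne : p.1 ≠ p.2 := fun h => hps.2 (h ▸ hps.1)
    have hsq : Matrix.single p.1 p.2 (B p.1 p.2) * Matrix.single p.1 p.2 (B p.1 p.2) = 0 :=
      Matrix.single_mul_single_of_ne _ _ _ _ hne.symm _
    let x : GL ι R := ⟨1 + Matrix.single p.1 p.2 (B p.1 p.2), 1 - Matrix.single p.1 p.2 (B p.1 p.2),
      by simp [add_mul, mul_sub, hsq], by simp [sub_mul, mul_add, hsq]⟩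
    refine ⟨x * g, by rw [map_mul, h1, K1.ofEquiv_elementary e hne _ x rfl, mul_one], ?_⟩
    have hz : Matrix.single p.1 p.2 (B p.1 p.2) *
        ∑ q ∈ t, Matrix.single q.1 q.2 (B q.1 q.2) = 0 := by
      rw [Finset.mul_sum]
      refine Finset.sum_eq_zero fun q _ => ?_
      by_cases hq : B q.1 q.2 = 0
      · rw [hq, Matrix.single_zero, mul_zero]
      · have hpq : p.2 ≠ q.1 := fun h => hps.2 (by rw [h]; exact (hB _ _ hq).1)
        exact Matrix.single_mul_single_of_ne _ _ _ _ hpq _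
    rw [Units.val_mul, h2, Finset.sum_insert hp, mul_add, mul_one, add_mul, hz]
    simp [x, add_assoc]

/-- The block diagonal matrix `a ⊥ d`. -/
def blockDiag (a : GL ι R) (d : GL κ R) : GL (ι ⊕ κ) R :=
  ⟨fromBlocks a.val 0 0 d.val, fromBlocks a⁻¹.val 0 0 d⁻¹.val,
    by simp [fromBlocks_multiply], by simp [fromBlocks_multiply]⟩

theorem blockDiag_mul (a b : GL ι R) (c d : GL κ R) :
    blockDiag (a * b) (c * d) = blockDiag a c * blockDiag b d := by
  refine Units.ext ?_
  simp [blockDiag, fromBlocks_multiply]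

/-- The block upper unitriangular matrix with corner `B`. -/
def blockUpper (B : Matrix ι κ R) : GL (ι ⊕ κ) R :=
  ⟨fromBlocks 1 B 0 1, fromBlocks 1 (-B) 0 1,
    by simp [fromBlocks_multiply], by simp [fromBlocks_multiply]⟩

/-- The block lower unitriangular matrix with corner `C`. -/
def blockLower (C : Matrix κ ι R) : GL (ι ⊕ κ) R :=
  ⟨fromBlocks 1 0 C 1, fromBlocks 1 0 (-C) 1,
    by simp [fromBlocks_multiply], by simp [fromBlocks_multiply]⟩

theorem K1.ofEquiv_blockUpper {n : ℕ} (e : ι ⊕ κ ≃ Fin n) (B : Matrix ι κ R) :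
    K1.ofEquiv R e (blockUpper B) = 1 := by
  refine K1.ofEquiv_eq_one_of_support e (Set.range Sum.inl) (fromBlocks 0 B 0 0) ?_ _ ?_
  · rintro (a | a) (b | b) <;> simp
  · rw [← fromBlocks_one, fromBlocks_add]
    simp [blockUpper]

theorem K1.ofEquiv_blockLower {n : ℕ} (e : ι ⊕ κ ≃ Fin n) (C : Matrix κ ι R) :
    K1.ofEquiv R e (blockLower C) = 1 := by
  refine K1.ofEquiv_eq_one_of_support e (Set.range Sum.inr) (fromBlocks 0 0 C 0) ?_ _ ?_
  · rintro (a | a) (b | b) <;> simp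
  · rw [← fromBlocks_one, fromBlocks_add]
    simp [blockLower]

theorem K1.ofEquiv_blockDiag_inv {n : ℕ} (e : ι ⊕ ι ≃ Fin n) (b : GL ι R) :
    K1.ofEquiv R e (blockDiag b b⁻¹) = 1 := by
  -- The first three factors multiply to `(0, b; -b⁻¹, 0)` and the last three to `(0, -1; 1, 0)`.
  have key : blockDiag b b⁻¹ = blockUpper b.val * blockLower (-b⁻¹.val) * blockUpper b.val *
      (blockUpper (-1) * blockLower 1 * blockUpper (-1)) := by
    refine Units.ext ?_
    simp [blockDiag, blockUpper, blockLower, fromBlocks_multiply]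
  rw [key]
  simp only [map_mul, K1.ofEquiv_blockUpper, K1.ofEquiv_blockLower, mul_one]

theorem K1.ofEquiv_finSumFinEquiv_blockDiag_one {n m : ℕ} (a : GL (Fin n) R) :
    K1.ofEquiv R finSumFinEquiv (blockDiag a (1 : GL (Fin m) R)) = K1.ofHom R n a := by
  rw [← K1.ofHom_stabHom (Nat.le_add_right n m)]
  refine congrArg (K1.ofHom R (n + m)) (Units.ext ?_)
  rw [coe_stabHom, stabMatrix_add_eq]
  rfl

theorem K1.exists_eq_ofHom (x : K1 R) : ∃ (n : ℕ) (g : GL (Fin n) R), K1.ofHom R n g = x := by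
  obtain ⟨y, rfl⟩ := QuotientGroup.mk_surjective x
  obtain ⟨n, g, rfl⟩ : ∃ m a, y = toStableGL m a := DirectLimit.exists_eq_mk _ y
  exact ⟨n, g, rfl⟩

/-- The Whitehead lemma: `K₁(R)` is commutative. -/
theorem K1.mul_comm (x y : K1 R) : x * y = y * x := by
  obtain ⟨n, a, rfl⟩ := K1.exists_eq_ofHom x
  obtain ⟨m, b, rfl⟩ := K1.exists_eq_ofHom y
  rw [← K1.ofHom_stabHom (le_max_left n m) a, ← K1.ofHom_stabHom (le_max_right n m) b]
  generalize stabHom (le_max_left n m) a = a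
  generalize stabHom (le_max_right n m) b = b
  rw [← K1.ofEquiv_finSumFinEquiv_blockDiag_one (m := max n m) a,
    ← K1.ofEquiv_finSumFinEquiv_blockDiag_one (m := max n m) b]
  -- Moving `b` to the second block does not change its class, and there it commutes with `a ⊥ 1`.
  have hb : K1.ofEquiv R finSumFinEquiv (blockDiag b (1 : GL (Fin (max n m)) R)) =
      K1.ofEquiv R finSumFinEquiv (blockDiag (1 : GL (Fin (max n m)) R) b) := by
    have : blockDiag b (1 : GL (Fin (max n m)) R) = blockDiag b b⁻¹ * blockDiag 1 b := by
      rw [← blockDiag_mul, mul_one, inv_mul_cancel]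
    rw [this, map_mul, K1.ofEquiv_blockDiag_inv, one_mul]
  rw [hb, ← map_mul, ← map_mul, ← blockDiag_mul, ← blockDiag_mul]
  simp only [mul_one, one_mul]

/-- The class in `K₁(R)` does not depend on the enumeration of the index set. -/
theorem K1.ofEquiv_eq {n m : ℕ} (e : ι ≃ Fin n) (e' : ι ≃ Fin m) :
    K1.ofEquiv R e = K1.ofEquiv R e' := by
  obtain rfl : n = m := by simpa using Fintype.card_congr (e.symm.trans e')
  ext g
  let σ : ι ≃ ι := e.trans e'.symm
  -- Changing the enumeration conjugates by this permutation matrix, which is invisible in a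
  -- commutative group.
  let p : GL ι R := ⟨(1 : Matrix ι ι R).submatrix σ id, (1 : Matrix ι ι R).submatrix id σ,
    by rw [← Matrix.submatrix_mul _ _ _ _ _ Function.bijective_id, one_mul,
      Matrix.submatrix_one_equiv],
    by rw [Matrix.submatrix_mul_equiv, one_mul, Matrix.submatrix_id_id]⟩
  have h1 : K1.ofEquiv R e g = K1.ofEquiv R e' (p⁻¹ * g * p) := by
    refine congrArg (K1.ofHom R n) (Units.ext ?_)
    ext a b
    simp only [Units.coe_map]
    change g.val (e.symm a) (e.symm b) =
      ((1 : Matrix ι ι R).submatrix id σ * g.val * (1 : Matrix ι ι R).submatrix σ id)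
        (e'.symm a) (e'.symm b)
    simp only [Matrix.mul_apply, Matrix.submatrix_apply, id, Matrix.one_apply]
    have hσ : ∀ x c, σ x = e'.symm c ↔ e.symm c = x := by
      intro x c
      rw [Equiv.symm_apply_eq, Equiv.trans_apply, e'.symm.apply_eq_iff_eq, eq_comm]
    simp [hσ, @eq_comm ι (e'.symm _), Finset.sum_ite_eq]
  rw [h1, map_mul, map_mul, K1.mul_comm _ (K1.ofEquiv R e' p), ← mul_assoc, ← map_mul,
    mul_inv_cancel, map_one, one_mul]

end GeneralIndex

/-! ### Classes of square matrices in `K₁(R) ∪ {0}` and Schur complements -/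

section MatrixClass

universe u

variable {R : Type u} [CommRing R]
variable {ι κ : Type*} [Fintype ι] [DecidableEq ι] [Fintype κ] [DecidableEq κ]

variable (R ι) in
/-- The homomorphism `GL_ι(R) → K₁(R)` for an arbitrary finite index set `ι`. -/
noncomputable def K1.ofGL : GL ι R →* K1 R := K1.ofEquiv R (Fintype.equivFin ι)

theorem K1.ofGL_fin {n : ℕ} (g : GL (Fin n) R) : K1.ofGL R (Fin n) g = K1.of g := by
  rw [K1.ofGL, K1.ofEquiv_eq _ (Equiv.refl (Fin n))]
  rfl

open Classical in
/-- The class of a square matrix in `K₁(R) ∪ {0}`, which is `0` if the matrix is not invertible. -/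
noncomputable def K1.matrixClass (A : Matrix ι ι R) : WithZero (K1 R) :=
  if h : IsUnit A then (K1.ofGL R ι h.unit : WithZero (K1 R)) else 0

theorem K1.matrixClass_coe (g : GL ι R) :
    K1.matrixClass g.val = (K1.ofGL R ι g : WithZero (K1 R)) := by
  rw [K1.matrixClass, dif_pos g.isUnit, IsUnit.unit_of_val_units]

theorem K1.matrixClass_eq_zero {A : Matrix ι ι R} (h : ¬ IsUnit A) : K1.matrixClass A = 0 :=
  dif_neg h

theorem K1.isUnit_of_matrixClass {A : Matrix ι ι R} (h : K1.matrixClass A ≠ 0) : IsUnit A := by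
  by_contra h'
  exact h (K1.matrixClass_eq_zero h')

theorem K1.matrixClass_ofMatrix {n : ℕ} (A : Matrix (Fin n) (Fin n) R) (hA : IsUnit A) :
    K1.matrixClass A = (K1.ofMatrix A hA : WithZero (K1 R)) := by
  rw [K1.ofMatrix, ← K1.ofGL_fin, ← K1.matrixClass_coe, IsUnit.unit_spec]

theorem K1.matrixClass_one : K1.matrixClass (1 : Matrix ι ι R) = 1 := by
  rw [← Units.val_one, K1.matrixClass_coe, map_one, WithZero.coe_one]

/-- Over a commutative ring the determinant shows that a product is invertible only if both factors
are, so the value `0` is consistent. Block identities can thus be used without tracking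
invertibility. -/
theorem K1.matrixClass_mul (A B : Matrix ι ι R) :
    K1.matrixClass (A * B) = K1.matrixClass A * K1.matrixClass B := by
  by_cases hA : IsUnit A
  · by_cases hB : IsUnit B
    · obtain ⟨a, rfl⟩ := hA
      obtain ⟨b, rfl⟩ := hB
      rw [← Units.val_mul, K1.matrixClass_coe, K1.matrixClass_coe, K1.matrixClass_coe, map_mul,
        WithZero.coe_mul]
    · rw [K1.matrixClass_eq_zero hB, mul_zero, K1.matrixClass_eq_zero]
      rw [Matrix.isUnit_iff_isUnit_det, Matrix.det_mul, IsUnit.mul_iff]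
      rw [Matrix.isUnit_iff_isUnit_det] at hB
      exact fun h => hB h.2
  · rw [K1.matrixClass_eq_zero hA, zero_mul, K1.matrixClass_eq_zero]
    rw [Matrix.isUnit_iff_isUnit_det, Matrix.det_mul, IsUnit.mul_iff]
    rw [Matrix.isUnit_iff_isUnit_det] at hA
    exact fun h => hA h.1

theorem K1.matrixClass_pow (A : Matrix ι ι R) (k : ℕ) :
    K1.matrixClass (A ^ k) = K1.matrixClass A ^ k := by
  induction k with
  | zero => simp [K1.matrixClass_one]
  | succ k ih => rw [pow_succ, pow_succ, K1.matrixClass_mul, ih]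

theorem K1.matrixClass_submatrix (e : κ ≃ ι) (A : Matrix ι ι R) :
    K1.matrixClass (A.submatrix e e) = K1.matrixClass A := by
  by_cases hA : IsUnit A
  · obtain ⟨a, rfl⟩ := hA
    have h : a.val.submatrix e e =
        (Units.map (Matrix.reindexAlgEquiv R R e.symm).toMonoidHom a : GL κ R).val := rfl
    rw [h, K1.matrixClass_coe, K1.matrixClass_coe, K1.ofGL, K1.ofGL,
      K1.ofEquiv_eq (Fintype.equivFin ι) (e.symm.trans (Fintype.equivFin κ))]
    rfl
  · rw [K1.matrixClass_eq_zero hA, K1.matrixClass_eq_zero]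
    rwa [Matrix.isUnit_submatrix_equiv]

theorem K1.matrixClass_one_add_of_support (s : Set ι) (B : Matrix ι ι R)
    (hB : ∀ a b, B a b ≠ 0 → a ∈ s ∧ b ∉ s) : K1.matrixClass (1 + B) = 1 := by
  have hsq : B * B = 0 := by
    ext a c
    rw [Matrix.mul_apply]
    refine Finset.sum_eq_zero fun b _ => ?_
    by_contra h
    exact (hB _ _ (left_ne_zero_of_mul h)).2 (hB _ _ (right_ne_zero_of_mul h)).1
  let g : GL ι R := ⟨1 + B, 1 - B, by simp [add_mul, mul_sub, hsq], by simp [sub_mul, mul_add, hsq]⟩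
  have h := K1.matrixClass_coe g
  rwa [K1.ofGL, K1.ofEquiv_eq_one_of_support _ s B hB g rfl] at h

theorem K1.matrixClass_blockUpper (B : Matrix ι κ R) :
    K1.matrixClass (fromBlocks 1 B 0 1) = 1 := by
  have h := K1.matrixClass_coe (blockUpper B)
  rwa [K1.ofGL, K1.ofEquiv_blockUpper] at h

theorem K1.matrixClass_blockLower (C : Matrix κ ι R) :
    K1.matrixClass (fromBlocks 1 0 C 1) = 1 := by
  have h := K1.matrixClass_coe (blockLower C)
  rwa [K1.ofGL, K1.ofEquiv_blockLower] at h

theorem K1.matrixClass_fromBlocks_one (A : Matrix ι ι R) :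
    K1.matrixClass (fromBlocks A 0 0 (1 : Matrix κ κ R)) = K1.matrixClass A := by
  by_cases hA : IsUnit A
  · let e := (Fintype.equivFin ι).symm
    let f := (Fintype.equivFin κ).symm
    rw [← K1.matrixClass_submatrix (Equiv.sumCongr e f), ← K1.matrixClass_submatrix e]
    have h : (fromBlocks A 0 0 (1 : Matrix κ κ R)).submatrix (Equiv.sumCongr e f)
        (Equiv.sumCongr e f) = fromBlocks (A.submatrix e e) 0 0 1 := by
      ext (i | i) (j | j) <;> simp [Matrix.one_apply]
    rw [h]
    obtain ⟨a, ha⟩ := (Matrix.isUnit_submatrix_equiv e e).2 hA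
    rw [← ha]
    have hd := K1.matrixClass_coe (blockDiag a (1 : GL (Fin (Fintype.card κ)) R))
    rw [K1.ofGL, K1.ofEquiv_eq _ finSumFinEquiv, K1.ofEquiv_finSumFinEquiv_blockDiag_one] at hd
    rw [K1.matrixClass_coe, K1.ofGL_fin]
    exact hd
  · rw [K1.matrixClass_eq_zero hA, K1.matrixClass_eq_zero]
    rw [Matrix.isUnit_iff_isUnit_det] at hA ⊢
    simpa using hA

theorem K1.matrixClass_fromBlocks_diag (A : Matrix ι ι R) (D : Matrix κ κ R) :
    K1.matrixClass (fromBlocks A 0 0 D) = K1.matrixClass A * K1.matrixClass D := by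
  have h : fromBlocks A 0 0 D = fromBlocks A 0 0 1 * fromBlocks 1 0 0 D := by
    simp [fromBlocks_multiply]
  rw [h, K1.matrixClass_mul, K1.matrixClass_fromBlocks_one,
    ← K1.matrixClass_submatrix (Equiv.sumComm κ ι)]
  have h2 : (fromBlocks (1 : Matrix ι ι R) 0 0 D).submatrix (Equiv.sumComm κ ι)
      (Equiv.sumComm κ ι) = fromBlocks D 0 0 1 := by
    ext (i | i) (j | j) <;> simp
  rw [h2, K1.matrixClass_fromBlocks_one]

/-- The class of a block matrix with invertible lower right corner is computed by the Schur
complement. -/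
theorem K1.matrixClass_fromBlocks_schur (A : Matrix ι ι R) (B : Matrix ι κ R) (C : Matrix κ ι R)
    (D D' : Matrix κ κ R) (hD : D * D' = 1) :
    K1.matrixClass (fromBlocks A B C D) =
      K1.matrixClass (A - B * D' * C) * K1.matrixClass D := by
  have hD' : D' * D = 1 := mul_eq_one_comm.1 hD
  have h : fromBlocks A B C D = fromBlocks 1 (B * D') 0 1 *
      fromBlocks (A - B * D' * C) 0 0 D * fromBlocks 1 0 (D' * C) 1 := by
    simp [fromBlocks_multiply, Matrix.mul_assoc, hD', ← Matrix.mul_assoc D D', hD]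
  rw [h, K1.matrixClass_mul, K1.matrixClass_mul, K1.matrixClass_blockUpper,
    K1.matrixClass_blockLower, one_mul, mul_one, K1.matrixClass_fromBlocks_diag]

theorem K1.matrixClass_fromBlocks_one_right (A : Matrix ι ι R) (B : Matrix ι κ R)
    (C : Matrix κ ι R) :
    K1.matrixClass (fromBlocks A B C 1) = K1.matrixClass (A - B * C) := by
  rw [K1.matrixClass_fromBlocks_schur A B C 1 1 (one_mul 1), Matrix.mul_one, K1.matrixClass_one, mul_one]

end MatrixClass

/-! ### Maps on `K₁` induced by ring maps into matrix rings -/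

section Functoriality

universe u v

variable {R : Type u} [CommRing R] {S : Type v} [CommRing S]
variable {ι κ : Type*} [Fintype ι] [DecidableEq ι] [Fintype κ] [DecidableEq κ]

/-- The ring homomorphism between matrix rings which replaces every entry `a` of a matrix by the
block `τ a`. -/
def blockMap (τ : R →+* Matrix κ κ S) (ι : Type*) [Fintype ι] [DecidableEq ι] :
    Matrix ι ι R →+* Matrix (ι × κ) (ι × κ) S :=
  (Matrix.compRingEquiv ι κ S).toRingHom.comp τ.mapMatrix

@[simp]
theorem blockMap_apply (τ : R →+* Matrix κ κ S) (A : Matrix ι ι R) (p q : ι × κ) :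
    blockMap τ ι A p q = τ (A p.1 q.1) p.2 q.2 := rfl

/-- The homomorphism `GL_n(R) → K₁(S)` induced by a ring homomorphism from `R` to a matrix ring
over `S`. -/
noncomputable def K1.liftAux (τ : R →+* Matrix κ κ S) (ι : Type*) [Fintype ι] [DecidableEq ι] :
    GL ι R →* K1 S :=
  (K1.ofGL S (ι × κ)).comp (Units.map (blockMap τ ι).toMonoidHom)

theorem K1.coe_liftAux (τ : R →+* Matrix κ κ S) (g : GL ι R) :
    (K1.liftAux τ ι g : WithZero (K1 S)) = K1.matrixClass (blockMap τ ι g.val) := by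
  rw [K1.liftAux, MonoidHom.comp_apply, ← K1.matrixClass_coe]
  rfl

theorem K1.liftAux_stabHom (τ : R →+* Matrix κ κ S) {n m : ℕ} (h : n ≤ m) (g : GL (Fin n) R) :
    K1.liftAux τ (Fin m) (stabHom h g) = K1.liftAux τ (Fin n) g := by
  obtain ⟨t, rfl⟩ := Nat.exists_eq_add_of_le h
  rw [← WithZero.coe_inj, K1.coe_liftAux, K1.coe_liftAux, coe_stabHom, stabMatrix_add_eq,
    ← K1.matrixClass_fromBlocks_one (κ := Fin t × κ) (blockMap τ (Fin n) g.val),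
    ← K1.matrixClass_submatrix
      ((Equiv.sumProdDistrib (Fin n) (Fin t) κ).symm.trans
        (Equiv.prodCongr finSumFinEquiv (Equiv.refl κ)))]
  congr 1
  ext (p | p) (q | q)
  · simp
  · simp
  · simp
  · obtain ⟨i, a⟩ := p
    obtain ⟨j, b⟩ := q
    by_cases hij : i = j <;> simp [Matrix.one_apply, hij]

/-- An off-diagonal entry becomes an off-diagonal block, supported in the rows of block `i` and in
columns outside it. -/
theorem K1.liftAux_elementaryGroup (τ : R →+* Matrix κ κ S) {n : ℕ} {g : GL (Fin n) R}
    (hg : g ∈ elementaryGroup R n) : K1.liftAux τ (Fin n) g = 1 := by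
  suffices elementaryGroup R n ≤ (K1.liftAux τ (Fin n)).ker from this hg
  refine (Subgroup.closure_le _).2 ?_
  rintro g ⟨i, j, c, hij, hg⟩
  change K1.liftAux τ (Fin n) g = 1
  rw [← WithZero.coe_inj, K1.coe_liftAux, hg, map_add, map_one, WithZero.coe_one]
  refine K1.matrixClass_one_add_of_support {p | p.1 = i} _ fun p q hpq => ?_
  rw [blockMap_apply, Matrix.single_apply] at hpq
  split_ifs at hpq with h
  · exact ⟨h.1.symm, fun h' => hij (h'.symm.trans h.2.symm)⟩
  · simp at hpq

/-- The homomorphism `K₁(R) → K₁(S)` induced by a ring homomorphism from `R` to a matrix ring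
over `S`. -/
noncomputable def K1.lift (τ : R →+* Matrix κ κ S) : K1 R →* K1 S :=
  QuotientGroup.lift (stableElementaryGroup R)
    { toFun := DirectLimit.lift _ (fun n g => K1.liftAux τ (Fin n) g)
        (fun _ _ h g => (K1.liftAux_stabHom τ h g).symm)
      map_one' := by
        rw [DirectLimit.one_def 0]
        exact map_one _
      map_mul' := fun x y => by
        induction x, y using DirectLimit.induction₂ with
        | ih n g h =>
          rw [DirectLimit.mul_def]
          exact map_mul _ g h }
    (by
      rintro _ ⟨n, g, hg, rfl⟩
      exact K1.liftAux_elementaryGroup τ hg)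

theorem K1.lift_ofGL_fin (τ : R →+* Matrix κ κ S) {n : ℕ} (g : GL (Fin n) R) :
    K1.lift τ (K1.ofGL R (Fin n) g) = K1.liftAux τ (Fin n) g := by
  rw [K1.ofGL_fin]
  rfl

theorem K1.exists_eq_matrixClass (x : K1 R) :
    ∃ (n : ℕ) (g : GL (Fin n) R), K1.matrixClass g.val = (x : WithZero (K1 R)) := by
  obtain ⟨n, g, rfl⟩ := K1.exists_eq_ofHom x
  exact ⟨n, g, by rw [K1.matrixClass_coe, K1.ofGL_fin]; rfl⟩

/-- Permits evaluation on any representative, over any finite index set. -/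
theorem K1.coe_lift (τ : R →+* Matrix κ κ S) {x : K1 R} {A : Matrix ι ι R}
    (hA : K1.matrixClass A = (x : WithZero (K1 R))) :
    (K1.lift τ x : WithZero (K1 S)) = K1.matrixClass (blockMap τ ι A) := by
  let e := (Fintype.equivFin ι).symm
  have hA' := hA
  rw [← K1.matrixClass_submatrix e] at hA'
  have hu : IsUnit (A.submatrix e e) :=
    K1.isUnit_of_matrixClass (by rw [hA']; exact WithZero.coe_ne_zero)
  obtain ⟨a, ha⟩ := hu
  rw [← ha, K1.matrixClass_coe, WithZero.coe_inj] at hA'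
  rw [← hA', K1.lift_ofGL_fin, K1.coe_liftAux, ha,
    ← K1.matrixClass_submatrix (Equiv.prodCongr e (Equiv.refl κ))]
  rfl

/-- The homomorphism `K₁(R) → K₁(S)` induced by a ring homomorphism `R → S`. -/
noncomputable def K1.map (f : R →+* S) : K1 R →* K1 S :=
  K1.lift ((Matrix.scalar Unit).comp f)

theorem K1.coe_map (f : R →+* S) {x : K1 R} {A : Matrix ι ι R}
    (hA : K1.matrixClass A = (x : WithZero (K1 R))) :
    (K1.map f x : WithZero (K1 S)) = K1.matrixClass (A.map f) := by
  rw [K1.map, K1.coe_lift _ hA, ← K1.matrixClass_submatrix (Equiv.prodUnique ι Unit).symm]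
  rfl

theorem K1.map_map {T : Type*} [CommRing T] (f : R →+* S) (g : S →+* T) (x : K1 R) :
    K1.map g (K1.map f x) = K1.map (g.comp f) x := by
  obtain ⟨n, a, ha⟩ := K1.exists_eq_matrixClass x
  rw [← WithZero.coe_inj, K1.coe_map g (K1.coe_map f ha).symm, K1.coe_map _ ha]
  rfl

theorem K1.map_id (x : K1 R) : K1.map (RingHom.id R) x = x := by
  obtain ⟨n, a, ha⟩ := K1.exists_eq_matrixClass x
  rw [← WithZero.coe_inj, K1.coe_map _ ha, ← ha]
  rfl

theorem K1.det_map (f : R →+* S) (x : K1 R) : K1.det S (K1.map f x) = Units.map f (K1.det R x) := by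
  obtain ⟨n, g, rfl⟩ := K1.exists_eq_ofHom x
  have hg : K1.matrixClass g.val = (K1.ofHom R n g : WithZero (K1 R)) := by
    rw [K1.matrixClass_coe, K1.ofGL_fin]; rfl
  have h : K1.map f (K1.ofHom R n g) = K1.of (Matrix.GeneralLinearGroup.map f g) := by
    rw [← WithZero.coe_inj, K1.coe_map f hg, ← K1.ofGL_fin, ← K1.matrixClass_coe]
    rfl
  rw [h, K1.det_of]
  exact Matrix.GeneralLinearGroup.map_det f g

end Functoriality

/-! ### Higman linearisation, nilpotence and truncated `k`-th roots -/

section Linearization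

open Polynomial

universe u v

variable {R : Type u} [CommRing R]

/-- Higman's linearisation trick: a matrix `1 + X B` of polynomials can be replaced by a matrix
`1 + X C` with `C` constant, uniformly for all evaluations of `X` at a matrix. -/
theorem exists_linearization (d : ℕ) {κ : Type} [Fintype κ] [DecidableEq κ] (B : Matrix κ κ R[X])
    (hB : ∀ i j, (B i j).natDegree ≤ d) :
    ∃ (m : ℕ) (C : Matrix (Fin m) (Fin m) R),
      ∀ {T : Type v} [CommRing T] {ι : Type} [Fintype ι] [DecidableEq ι]
        (τ : R[X] →+* Matrix ι ι T),
        K1.matrixClass (blockMap τ κ (1 + (X : R[X]) • B)) =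
          K1.matrixClass (blockMap τ (Fin m) (1 + (X : R[X]) • C.map Polynomial.C)) := by
  induction d generalizing κ with
  | zero =>
    let e := (Fintype.equivFin κ).symm
    refine ⟨Fintype.card κ, Matrix.of fun i j => (B (e i) (e j)).coeff 0, fun τ => ?_⟩
    rw [← K1.matrixClass_submatrix (Equiv.prodCongr e (Equiv.refl _))]
    congr 1
    ext p q
    have h : B (e p.1) (e q.1) = Polynomial.C ((B (e p.1) (e q.1)).coeff 0) :=
      Polynomial.eq_C_of_natDegree_le_zero (hB _ _)
    simp only [Matrix.submatrix_apply, blockMap_apply, Equiv.prodCongr_apply, Prod.map_fst,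
      Prod.map_snd, Matrix.add_apply, Matrix.smul_apply, Matrix.map_apply, Matrix.of_apply, ← h,
      Matrix.one_apply, e.injective.eq_iff, Equiv.refl_apply]
  | succ d ih =>
    -- Split off the leading part, `B = B' + X^(d+1) β`. Then `1 + X B` is the Schur complement of
    -- the lower right `1` in the block matrix with rows `(1 + X B', -X^(d+1) β)` and `(X, 1)`. That
    -- matrix is `1 + X` times a matrix of degree at most `d`.
    let β : Matrix κ κ R[X] := Matrix.of fun i j => Polynomial.C ((B i j).coeff (d + 1))
    let B' : Matrix κ κ R[X] := B - (X ^ (d + 1) : R[X]) • β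
    have hB' : ∀ i j, (B' i j).natDegree ≤ d := by
      intro i j
      rw [Polynomial.natDegree_le_iff_coeff_eq_zero]
      intro N hN
      have h1 : (B' i j).coeff N =
          (B i j).coeff N - (X ^ (d + 1) * Polynomial.C ((B i j).coeff (d + 1))).coeff N :=
        Polynomial.coeff_sub _ _ _
      rw [h1, Polynomial.coeff_X_pow_mul', Polynomial.coeff_C, if_pos (by omega)]
      rcases Nat.eq_or_lt_of_le (Nat.succ_le_of_lt hN) with h | h
      · simp [← h]
      · rw [if_neg (by omega), sub_zero]
        exact (Polynomial.natDegree_le_iff_coeff_eq_zero.1 (hB i j)) N h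
    have hX : ∀ i j, ((-((X ^ d : R[X]) • β)) i j).natDegree ≤ d := by
      intro i j
      rw [Matrix.neg_apply, Polynomial.natDegree_neg]
      exact (Polynomial.natDegree_mul_C_le _ _).trans (Polynomial.natDegree_X_pow_le d)
    obtain ⟨m, C, hC⟩ := ih (fromBlocks B' (-((X ^ d : R[X]) • β)) 1 0) (by
      rintro (i | i) (j | j)
      · exact hB' i j
      · exact hX i j
      · rw [fromBlocks_apply₂₁, Matrix.one_apply]
        split_ifs <;> simp
      · simp)
    refine ⟨m, C, fun {T} _ {ι} _ _ τ => ?_⟩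
    rw [← hC τ, ← K1.matrixClass_submatrix (Equiv.sumProdDistrib κ κ ι).symm]
    have h1 : (blockMap τ (κ ⊕ κ)
          (1 + (X : R[X]) • fromBlocks B' (-((X ^ d : R[X]) • β)) 1 0)).submatrix
        (Equiv.sumProdDistrib κ κ ι).symm (Equiv.sumProdDistrib κ κ ι).symm =
        fromBlocks (blockMap τ κ (1 + (X : R[X]) • B'))
          (blockMap τ κ ((X : R[X]) • -((X ^ d : R[X]) • β)))
          (blockMap τ κ ((X : R[X]) • 1)) 1 := by
      ext (p | p) (q | q)
      · simp [Matrix.one_apply, Prod.ext_iff]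
      · simp
      · simp [Matrix.one_apply]
      · obtain ⟨i, a⟩ := p
        obtain ⟨j, b⟩ := q
        by_cases hij : i = j <;> simp [Matrix.one_apply, hij]
    rw [h1, K1.matrixClass_fromBlocks_one_right, ← map_mul, ← map_sub]
    congr 2
    simp only [B', smul_sub, smul_neg, smul_smul, Matrix.mul_smul, mul_one]
    simp only [← pow_succ']
    abel

/-- The inverse has coefficients `(-C)ⁿ`, as for the geometric series; being a polynomial, it has
only finitely many nonzero ones. -/
theorem isNilpotent_of_isUnit_one_add_X_smul {κ : Type*} [Fintype κ] [DecidableEq κ]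
    (C : Matrix κ κ R) (hC : IsUnit (1 + (X : R[X]) • C.map Polynomial.C)) : IsNilpotent C := by
  obtain ⟨u, hu⟩ := hC
  let q : (Matrix κ κ R)[X] := matPolyEquiv u⁻¹.val
  have h1 : (1 + X * Polynomial.C C) * q = 1 := by
    have h : matPolyEquiv u.val = 1 + X * Polynomial.C C := by
      rw [hu, map_add, map_one, matPolyEquiv_map_smul, matPolyEquiv_map_C, Polynomial.map_X]
    rw [← h, ← map_mul, Units.mul_inv, map_one]
  have h0 : q.coeff 0 = 1 := by
    have := congrArg (fun p => Polynomial.coeff p 0) h1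
    simpa [add_mul, mul_assoc] using this
  have hs : ∀ n, q.coeff (n + 1) = -C * q.coeff n := by
    intro n
    have := congrArg (fun p => Polynomial.coeff p (n + 1)) h1
    simp only [add_mul, one_mul, mul_assoc, coeff_add, coeff_X_mul, coeff_C_mul, coeff_one] at this
    rw [if_neg (by omega)] at this
    rw [neg_mul]
    exact eq_neg_of_add_eq_zero_left this
  have hp : ∀ n, q.coeff n = (-C) ^ n := by
    intro n
    induction n with
    | zero => simp [h0]
    | succ n ih => rw [hs, ih, pow_succ']
  have : IsNilpotent (-C) := ⟨q.natDegree + 1, by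
    rw [← hp]
    exact Polynomial.coeff_eq_zero_of_natDegree_lt (Nat.lt_succ_self _)⟩
  simpa using this.neg

/-- Truncated `k`-th roots of `1 - X`, for `k` a unit. -/
theorem exists_pow_eq_one_sub_X_add {k : ℕ} (hk : IsUnit (k : R)) (M : ℕ) :
    ∃ b q : R[X], (1 + X * b) ^ k = 1 - X + X ^ (M + 1) * q := by
  obtain ⟨c, hc⟩ := hk.exists_right_inv
  have hcC : (k : R[X]) * Polynomial.C c = 1 := by
    rw [← Polynomial.C_eq_natCast, ← Polynomial.C_mul, hc, Polynomial.C_1]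
  have hpow : ∀ (b : R[X]) (l : ℕ), ∃ w, (1 + X * b) ^ l = 1 + X * w := by
    intro b l
    have h : (X : R[X]) ∣ (1 + X * b) ^ l - 1 ^ l :=
      (Dvd.intro b (by ring)).trans (sub_dvd_pow_sub_pow (1 + X * b) 1 l)
    obtain ⟨w, hw⟩ := h
    exact ⟨w, by rw [← hw]; ring⟩
  induction M with
  | zero =>
    obtain ⟨w, hw⟩ := hpow 0 k
    exact ⟨0, w + 1, by rw [hw]; ring⟩
  | succ M ih =>
    obtain ⟨b, q, h⟩ := ih
    obtain ⟨w, hw⟩ := hpow b (k - 1)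
    obtain ⟨q', hq'⟩ : ∃ q', q = Polynomial.C (q.coeff 0) + X * q' :=
      ⟨q.divX, by rw [add_comm]; exact (Polynomial.X_mul_divX_add q).symm⟩
    set a := Polynomial.C (q.coeff 0)
    -- Newton step: since `(1 + X b)^(k-1)` is `1` modulo `X` and `k c = 1`, the linear term of the
    -- expansion cancels the error `a X^(M+1)` modulo `X^(M+2)`; the quadratic term has still higher
    -- order.
    let δ : R[X] := -(Polynomial.C c * a) * X ^ (M + 1)
    obtain ⟨z, hz⟩ := Polynomial.powAddExpansion (1 + X * b) δ k
    refine ⟨b - Polynomial.C c * a * X ^ M,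
      q' - a * w + z * (Polynomial.C c * a) ^ 2 * X ^ M, ?_⟩
    have h1 : 1 + X * (b - Polynomial.C c * a * X ^ M) = 1 + X * b + δ := by
      simp only [δ]; ring
    rw [h1, hz, h, hw, hq']
    simp only [δ]
    linear_combination (-(a * X ^ (M + 1) * (1 + X * w))) * hcC

end Linearization

/-! ### `NK₁` has no `k`-torsion -/

section NilK

open Polynomial

universe u

variable {R : Type u} [CommRing R]

theorem K1.matrixClass_blockMap_unique {ι κ : Type} [Fintype ι] [DecidableEq ι] [Fintype κ]
    [DecidableEq κ] [Unique κ] {S : Type*} [CommRing S] (τ : R →+* Matrix ι ι S)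
    (A : Matrix κ κ R) :
    K1.matrixClass (blockMap τ κ A) = K1.matrixClass (τ (A default default)) := by
  rw [← K1.matrixClass_submatrix (Equiv.uniqueProd ι κ).symm]
  rfl

theorem K1.matrixClass_blockMap_scalar {κ : Type} [Fintype κ] [DecidableEq κ] (A : Matrix κ κ R) :
    K1.matrixClass (blockMap (Matrix.scalar Unit) κ A) = K1.matrixClass A := by
  rw [← K1.matrixClass_submatrix (Equiv.prodUnique κ Unit).symm]
  rfl

theorem exists_eq_one_add_X_smul {κ : Type*} [DecidableEq κ] (A : Matrix κ κ R[X])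
    (hA : A.map (Polynomial.evalRingHom 0) = 1) :
    ∃ B : Matrix κ κ R[X], A = 1 + (X : R[X]) • B := by
  refine ⟨Matrix.of fun i j => (A i j).divX, ?_⟩
  ext1 i j
  have h1 : (A i j).coeff 0 = (1 : Matrix κ κ R) i j := by
    rw [Polynomial.coeff_zero_eq_eval_zero, ← hA]
    rfl
  have h2 := Polynomial.X_mul_divX_add (A i j)
  rw [h1, Matrix.one_apply, apply_ite Polynomial.C, map_one, map_zero] at h2
  rw [Matrix.add_apply, Matrix.smul_apply, Matrix.one_apply, Matrix.of_apply, smul_eq_mul,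
    add_comm, h2]

/-- Every element of `NK₁(R)` is represented by a matrix `1 + X ν` with `ν` nilpotent. -/
theorem K1.exists_isNilpotent_of_map_eval_eq_one (x : K1 R[X])
    (h0 : K1.map (Polynomial.evalRingHom 0) x = 1) :
    ∃ (m : ℕ) (ν : Matrix (Fin m) (Fin m) R), IsNilpotent ν ∧
      K1.matrixClass (1 + (X : R[X]) • ν.map Polynomial.C) = (x : WithZero (K1 R[X])) := by
  obtain ⟨n, g, hg⟩ := K1.exists_eq_matrixClass x
  let ε : R[X] →+* R := Polynomial.evalRingHom 0
  let g₀ : GL (Fin n) R := Matrix.GeneralLinearGroup.map ε g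
  let h : GL (Fin n) R[X] := Matrix.GeneralLinearGroup.map Polynomial.C g₀
  -- The constant matrix `h = g(0)` has trivial class by `h0`, so dividing by it normalises `g` to
  -- the form `1 + X B`.
  have hh : K1.ofGL R[X] (Fin n) h = 1 := by
    have h1 := K1.coe_map Polynomial.C (K1.coe_map ε hg).symm
    rw [h0, map_one] at h1
    rw [← WithZero.coe_inj, ← K1.matrixClass_coe, WithZero.coe_one]
    exact h1.symm
  have hx : K1.matrixClass (g * h⁻¹).val = (x : WithZero (K1 R[X])) := by
    rw [K1.matrixClass_coe, map_mul, map_inv, hh, inv_one, mul_one, ← K1.matrixClass_coe, hg]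
  have hε : Matrix.GeneralLinearGroup.map ε (g * h⁻¹) = 1 := by
    have : Matrix.GeneralLinearGroup.map ε h = g₀ := by
      refine Units.ext ?_
      ext i j
      simp [h, ε]
    rw [map_mul, map_inv, this, mul_inv_cancel]
  obtain ⟨B, hB⟩ := exists_eq_one_add_X_smul (g * h⁻¹).val (congrArg Units.val hε)
  obtain ⟨m, ν, hν⟩ := exists_linearization
    (Finset.univ.sup fun p : Fin n × Fin n => (B p.1 p.2).natDegree) B
    (fun i j => Finset.le_sup (f := fun p : Fin n × Fin n => (B p.1 p.2).natDegree)
      (Finset.mem_univ (i, j)))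
  have hν' : K1.matrixClass (1 + (X : R[X]) • ν.map Polynomial.C) = (x : WithZero (K1 R[X])) := by
    rw [← hx, hB, ← K1.matrixClass_blockMap_scalar, ← hν, K1.matrixClass_blockMap_scalar]
  refine ⟨m, ν, isNilpotent_of_isUnit_one_add_X_smul ν (K1.isUnit_of_matrixClass ?_), hν'⟩
  rw [hν']
  exact WithZero.coe_ne_zero

/-- `NK₁(R)` has no `k`-torsion if `k` is a unit of `R`. -/
theorem K1.eq_one_of_map_eval_eq_one_of_pow_eq_one {k : ℕ} (hk : IsUnit (k : R)) (x : K1 R[X])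
    (h0 : K1.map (Polynomial.evalRingHom 0) x = 1) (hx : x ^ k = 1) : x = 1 := by
  obtain ⟨m, ν, ⟨M, hM⟩, hν⟩ := K1.exists_isNilpotent_of_map_eval_eq_one x h0
  obtain ⟨b, q, hb⟩ := exists_pow_eq_one_sub_X_add hk M
  -- The polynomial `1 + X b` is linearised as a `1 × 1` matrix, so that it may later be evaluated
  -- at the matrix `U`.
  obtain ⟨m', D, hD⟩ := exists_linearization.{u, u} b.natDegree
    (Matrix.of fun _ _ : Unit => b) (fun _ _ => le_rfl)
  let U : Matrix (Fin m) (Fin m) R[X] := -((X : R[X]) • ν.map Polynomial.C)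
  let V : Matrix (Fin m') (Fin m') R[X] := -((X : R[X]) • D.map Polynomial.C)
  let τ₁ : R[X] →+* Matrix (Fin m) (Fin m) R[X] := (Polynomial.aeval U).toRingHom
  let τ₂ : R[X] →+* Matrix (Fin m') (Fin m') R[X] := (Polynomial.aeval V).toRingHom
  have hXU : τ₁ X = U := Polynomial.aeval_X U
  have hXV : τ₂ X = V := Polynomial.aeval_X V
  have hCU : ∀ r : R, τ₁ (Polynomial.C r) = algebraMap R _ r := Polynomial.aeval_C U
  have hCV : ∀ r : R, τ₂ (Polynomial.C r) = algebraMap R _ r := Polynomial.aeval_C V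
  -- Both sides are `1 - X D ⊗ ν`, up to exchanging the tensor factors.
  have hswap : (blockMap τ₂ (Fin m) (1 + (X : R[X]) • ν.map Polynomial.C)).submatrix
      (Equiv.prodComm (Fin m') (Fin m)) (Equiv.prodComm (Fin m') (Fin m)) =
      blockMap τ₁ (Fin m') (1 + (X : R[X]) • D.map Polynomial.C) := by
    rw [map_add, map_add, map_one, map_one, Matrix.submatrix_add, Pi.add_apply, Pi.add_apply,
      Matrix.submatrix_one_equiv]
    congr 1
    ext1 p q
    simp only [Matrix.submatrix_apply, blockMap_apply, Matrix.smul_apply, Matrix.map_apply,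
      smul_eq_mul, map_mul, hXU, hXV, hCU, hCV, Algebra.algebraMap_eq_smul_one,
      Matrix.mul_smul, mul_one]
    simp [U, V, Polynomial.smul_eq_C_mul]
    ring
  have hlift : (K1.lift τ₂ x : WithZero (K1 R[X])) = K1.matrixClass (τ₁ (1 + X * b)) := by
    rw [K1.coe_lift τ₂ hν, ← K1.matrixClass_submatrix (Equiv.prodComm (Fin m') (Fin m)), hswap,
      ← hD τ₁, K1.matrixClass_blockMap_unique]
    rfl
  have hU : U ^ (M + 1) = 0 := by
    have : (ν.map Polynomial.C : Matrix (Fin m) (Fin m) R[X]) ^ M = 0 := by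
      rw [← RingHom.mapMatrix_apply, ← map_pow, hM, map_zero]
    rw [neg_pow, _root_.smul_pow, pow_succ (ν.map _), this, zero_mul, smul_zero, mul_zero]
  have hroot : K1.lift τ₂ x ^ k = x := by
    rw [← WithZero.coe_inj, WithZero.coe_pow, hlift, ← K1.matrixClass_pow, ← map_pow, hb, ← hν,
      map_add, map_sub, map_one, map_mul, map_pow, hXU, hU, zero_mul, add_zero, sub_neg_eq_add]
  rw [← hroot, ← map_pow, hx, map_one]

end NilK

universe u

/-! ### `SK₁` of a local ring -/

section LocalRing

variable {R : Type u} [CommRing R]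

theorem K1.det_of_matrixClass {n : ℕ} {A : Matrix (Fin n) (Fin n) R} {x : K1 R}
    (h : K1.matrixClass A = (x : WithZero (K1 R))) : (K1.det R x : R) = A.det := by
  obtain ⟨a, rfl⟩ := K1.isUnit_of_matrixClass (h.symm ▸ WithZero.coe_ne_zero)
  rw [K1.matrixClass_coe, WithZero.coe_inj, K1.ofGL_fin] at h
  rw [← h, K1.det_of]
  rfl

/-- Otherwise the last column vanishes over the residue field, and with it the determinant. -/
theorem exists_isUnit_apply_last [IsLocalRing R] {n : ℕ} (A : Matrix (Fin (n + 1)) (Fin (n + 1)) R)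
    (hA : IsUnit A) : ∃ i, IsUnit (A i (Fin.last n)) := by
  by_contra! h
  have h0 : (IsLocalRing.residue R) A.det = 0 := by
    rw [RingHom.map_det]
    refine Matrix.det_eq_zero_of_column_eq_zero (Fin.last n) fun i => ?_
    exact (IsLocalRing.residue_eq_zero_iff _).2 ((IsLocalRing.mem_maximalIdeal _).2 (h i))
  rw [IsLocalRing.residue_eq_zero_iff, IsLocalRing.mem_maximalIdeal] at h0
  exact h0 ((Matrix.isUnit_iff_isUnit_det A).1 hA)

/-- If the corner is not a unit, adding a row whose last entry is a unit makes it one, because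
nonunits of a local ring are closed under addition. -/
theorem K1.exists_isUnit_last_last [IsLocalRing R] {n : ℕ}
    (A : Matrix (Fin (n + 1)) (Fin (n + 1)) R) (hA : IsUnit A) :
    ∃ A' : Matrix (Fin (n + 1)) (Fin (n + 1)) R,
      K1.matrixClass A' = K1.matrixClass A ∧ IsUnit (A' (Fin.last n) (Fin.last n)) := by
  by_cases h : IsUnit (A (Fin.last n) (Fin.last n))
  · exact ⟨A, rfl, h⟩
  obtain ⟨i, hi⟩ := exists_isUnit_apply_last A hA
  have hne : i ≠ Fin.last n := by
    rintro rfl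
    exact h hi
  refine ⟨(1 + Matrix.single (Fin.last n) i 1) * A, ?_, ?_⟩
  · rw [K1.matrixClass_mul, K1.matrixClass_one_add_of_support {Fin.last n}, one_mul]
    intro a b hab
    rw [Matrix.single_apply] at hab
    split_ifs at hab with h'
    · exact ⟨h'.1.symm, fun hb => hne (h'.2.trans hb)⟩
    · simp at hab
  · by_contra h'
    rw [add_mul, one_mul, Matrix.add_apply, Matrix.single_mul_apply_same, one_mul] at h'
    have hn : -A (Fin.last n) (Fin.last n) ∈ nonunits R := by rwa [mem_nonunits_iff, IsUnit.neg_iff]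
    have := IsLocalRing.nonunits_add h' hn
    rw [add_neg_cancel_comm] at this
    exact this hi

/-- Induction on the size: once the corner is a unit, its Schur complement is a smaller matrix, and
the corner contributes a `1 × 1` factor. -/
theorem K1.exists_matrixClass_fin_one [IsLocalRing R] {n : ℕ} (A : Matrix (Fin n) (Fin n) R)
    (hA : IsUnit A) : ∃ D : Matrix (Fin 1) (Fin 1) R, K1.matrixClass A = K1.matrixClass D := by
  induction n with
  | zero => exact ⟨1, by rw [Subsingleton.elim A 1, K1.matrixClass_one, K1.matrixClass_one]⟩
  | succ n ih =>
    obtain ⟨A', hA', hu⟩ := K1.exists_isUnit_last_last A hA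
    have hne : K1.matrixClass A' ≠ 0 := by
      obtain ⟨a, rfl⟩ := hA
      rw [hA', K1.matrixClass_coe]
      exact WithZero.coe_ne_zero
    let E : Matrix (Fin n ⊕ Fin 1) (Fin n ⊕ Fin 1) R := A'.submatrix finSumFinEquiv finSumFinEquiv
    have hE : K1.matrixClass E = K1.matrixClass A' := K1.matrixClass_submatrix _ _
    have hD : E.toBlocks₂₂ * E.toBlocks₂₂⁻¹ = 1 := by
      refine Matrix.mul_nonsing_inv _ ?_
      rw [Matrix.det_fin_one]
      exact hu
    have hs := K1.matrixClass_fromBlocks_schur E.toBlocks₁₁ E.toBlocks₁₂ E.toBlocks₂₁ _ _ hD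
    rw [fromBlocks_toBlocks, hE] at hs
    obtain ⟨D, hD'⟩ := ih _ (K1.isUnit_of_matrixClass (left_ne_zero_of_mul (hs ▸ hne)))
    exact ⟨D * E.toBlocks₂₂, by rw [← hA', hs, hD', K1.matrixClass_mul]⟩

/-- `SK₁` of a local ring is trivial. -/
theorem K1.eq_one_of_det_eq_one [IsLocalRing R] (x : K1 R) (hx : K1.det R x = 1) : x = 1 := by
  obtain ⟨n, a, ha⟩ := K1.exists_eq_matrixClass x
  obtain ⟨D, hD⟩ := K1.exists_matrixClass_fin_one a.val a.isUnit
  rw [hD] at ha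
  have h1 := K1.det_of_matrixClass ha
  rw [hx, Units.val_one, Matrix.det_fin_one] at h1
  have h2 : D = 1 := by
    ext i j
    rw [Subsingleton.elim i 0, Subsingleton.elim j 0, ← h1, Matrix.one_apply_eq]
  rw [h2, K1.matrixClass_one] at ha
  exact (WithZero.coe_inj.1 (ha.symm.trans WithZero.coe_one.symm))

end LocalRing

/-! ### Homotopy from the degree zero projection to the identity -/

section Graded

open Polynomial

variable {R : Type u} [CommRing R] (𝒜 : ℕ → AddSubgroup R) [GradedRing 𝒜]

/-- The ring homomorphism `R → R[X]` which maps a homogeneous element `r` of degree `i` to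
`r Xⁱ`. -/
noncomputable def gradedToPolynomial : R →+* R[X] :=
  (DirectSum.toSemiring (fun i => (Polynomial.monomial i).toAddMonoidHom.comp (𝒜 i).subtype)
    rfl (fun _ _ => (Polynomial.monomial_mul_monomial _ _ _ _).symm)).comp
    (DirectSum.decomposeRingEquiv 𝒜).toRingHom

theorem gradedToPolynomial_of_mem {i : ℕ} {r : R} (hr : r ∈ 𝒜 i) :
    gradedToPolynomial 𝒜 r = Polynomial.monomial i r := by
  rw [gradedToPolynomial, RingHom.comp_apply]
  have h : (DirectSum.decomposeRingEquiv 𝒜).toRingHom r = DirectSum.of (𝒜 ·) i ⟨r, hr⟩ :=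
    DirectSum.decompose_of_mem 𝒜 hr
  rw [h]
  exact DirectSum.toSemiring_of _ _ _ _ _

theorem evalRingHom_one_comp_gradedToPolynomial :
    (Polynomial.evalRingHom 1).comp (gradedToPolynomial 𝒜) = RingHom.id R := by
  ext r
  induction r using DirectSum.Decomposition.inductionOn 𝒜 with
  | zero => simp
  | homogeneous r => simp [gradedToPolynomial_of_mem 𝒜 r.2]
  | add r s hr hs => rw [map_add, map_add, hr, hs]

theorem evalRingHom_zero_comp_gradedToPolynomial :
    (Polynomial.evalRingHom 0).comp (gradedToPolynomial 𝒜) = GradedRing.projZeroRingHom 𝒜 := by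
  ext r
  induction r using DirectSum.Decomposition.inductionOn 𝒜 with
  | zero => simp
  | @homogeneous i r =>
    rw [RingHom.comp_apply, gradedToPolynomial_of_mem 𝒜 r.2, GradedRing.projZeroRingHom_apply]
    rcases Nat.eq_zero_or_pos i with rfl | hi
    · rw [DirectSum.decompose_of_mem_same 𝒜 r.2]
      simp
    · rw [DirectSum.decompose_of_mem_ne 𝒜 r.2 hi.ne']
      simp [hi.ne']
  | add r s hr hs => rw [map_add, map_add, hr, hs]

/-- A `k`-torsion element of `K₁` of a graded ring comes from the degree zero part, if `k` is a
unit. -/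
theorem K1.map_projZero_eq_self {k : ℕ} (hk : IsUnit (k : R)) (x : K1 R) (hx : x ^ k = 1) :
    K1.map (GradedRing.projZeroRingHom 𝒜) x = x := by
  let y : K1 R[X] := K1.map (gradedToPolynomial 𝒜) x
  let z : K1 R := K1.map (Polynomial.evalRingHom 0) y
  have hC (a : R) : ((Polynomial.evalRingHom a).comp Polynomial.C) = RingHom.id R := by
    ext r
    simp
  -- This quotient dies at `X = 0` and is `k`-torsion, so it is a torsion element of `NK₁(R)`. Hence
  -- `y` is constant, and its values at `0` and `1` agree.
  have hyz : y * (K1.map Polynomial.C z)⁻¹ = 1 := by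
    refine K1.eq_one_of_map_eval_eq_one_of_pow_eq_one hk _ ?_ ?_
    · rw [map_mul, map_inv, K1.map_map Polynomial.C, hC, K1.map_id, mul_inv_cancel]
    · have hy : y ^ k = 1 := by rw [← map_pow, hx, map_one]
      have hz : z ^ k = 1 := by rw [← map_pow, hy, map_one]
      rw [Commute.mul_pow (K1.mul_comm _ _), hy, inv_pow, ← map_pow, hz, map_one, inv_one, mul_one]
  have h1 := congrArg (K1.map (Polynomial.evalRingHom 1)) (mul_inv_eq_one.1 hyz)
  rw [K1.map_map, K1.map_map, hC, K1.map_id, evalRingHom_one_comp_gradedToPolynomial,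
    K1.map_id] at h1
  rw [← evalRingHom_zero_comp_gradedToPolynomial, ← K1.map_map]
  exact h1.symm

end Graded

/-- A unipotent element whose `k`-th power is `1` is trivial, if `k` is a unit. -/
theorem eq_one_of_isNilpotent_sub_one_of_pow_eq_one {R : Type*} [CommRing R] {k : ℕ}
    (hk : IsUnit (k : R)) {a : R} (ha : IsNilpotent (a - 1)) (h : a ^ k = 1) : a = 1 := by
  obtain ⟨c, hc⟩ := Polynomial.powAddExpansion 1 (a - 1) k
  have h1 : (a - 1) * (k + c * (a - 1)) = 0 := by
    rw [add_sub_cancel, h, one_pow, one_pow] at hc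
    linear_combination -hc
  have hu : IsUnit (k + c * (a - 1)) :=
    IsNilpotent.isUnit_add_left_of_commute ((Commute.all _ _).isNilpotent_mul_left ha) hk
      (Commute.all _ _)
  exact sub_eq_zero.1 ((hu.mul_left_eq_zero).1 h1)

/-- The characteristic polynomial of `-N` differs from `Xⁿ` by a nilpotent; evaluate at `X = 1`. -/
theorem isNilpotent_det_one_add_sub_one {R : Type*} [CommRing R] {n : ℕ}
    {N : Matrix (Fin n) (Fin n) R} (hN : IsNilpotent N) : IsNilpotent ((1 + N).det - 1) := by
  have h := (Matrix.isNilpotent_charpoly_sub_pow_of_isNilpotent hN.neg).map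
    (Polynomial.evalRingHom 1)
  simpa [Matrix.eval_charpoly] using h

end AlgebraicK

theorem theorem2 {R : Type*} [CommRing R] (𝒜 : ℕ → AddSubgroup R) [GradedRing 𝒜]
    (k : ℕ) (hk : IsUnit (k : 𝒜 0)) :
    (∀ (n r : ℕ) (N : ℕ → Matrix (Fin n) (Fin n) R),
      (∀ i ≤ r, ∀ a b, N i a b ∈ 𝒜 i) →
      ∀ hN : IsNilpotent (∑ i ∈ Finset.range (r + 1), N i),
        AlgebraicK.K1.ofMatrix (1 + ∑ i ∈ Finset.range (r + 1), N i) hN.isUnit_one_add ^ k = 1 →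
        AlgebraicK.K1.ofMatrix (1 + ∑ i ∈ Finset.range (r + 1), N i) hN.isUnit_one_add ∈
            AlgebraicK.SK1 R ∧
          ∃ h₀ : IsUnit (1 + N 0),
            AlgebraicK.K1.ofMatrix (1 + ∑ i ∈ Finset.range (r + 1), N i) hN.isUnit_one_add =
              AlgebraicK.K1.ofMatrix (1 + N 0) h₀) ∧
    (IsReduced (𝒜 0) → IsLocalRing (𝒜 0) → ∀ x : AlgebraicK.SK1 R, x ^ k = 1 → x = 1) := by
  have hkR : IsUnit (k : R) := by
    have h := hk.map (algebraMap (𝒜 0) R)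
    rwa [map_natCast] at h
  refine ⟨fun n r N hNmem hN hpow => ?_, fun _ _ x hx => ?_⟩
  · set A : Matrix (Fin n) (Fin n) R := 1 + ∑ i ∈ Finset.range (r + 1), N i with hA
    set x : AlgebraicK.K1 R := AlgebraicK.K1.ofMatrix A hN.isUnit_one_add with hx
    have hAx : AlgebraicK.K1.matrixClass A = (x : WithZero (AlgebraicK.K1 R)) :=
      AlgebraicK.K1.matrixClass_ofMatrix A hN.isUnit_one_add
    have hproj : (∑ i ∈ Finset.range (r + 1), N i).map (GradedRing.projZeroRingHom 𝒜) = N 0 := by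
      ext a b
      rw [Matrix.map_apply, Matrix.sum_apply, map_sum, Finset.sum_eq_single_of_mem 0 (by simp)]
      · rw [GradedRing.projZeroRingHom_apply,
          DirectSum.decompose_of_mem_same 𝒜 (hNmem 0 (Nat.zero_le r) a b)]
      · intro i hi hi0
        rw [GradedRing.projZeroRingHom_apply, DirectSum.decompose_of_mem_ne 𝒜
          (hNmem i (Nat.lt_succ_iff.1 (Finset.mem_range.1 hi)) a b) hi0]
    have hprojA : A.map (GradedRing.projZeroRingHom 𝒜) = 1 + N 0 := by
      rw [← hproj, hA, ← RingHom.mapMatrix_apply, map_add, map_one]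
      rfl
    have hN0 : IsNilpotent (N 0) := by
      rw [← hproj]
      exact hN.map (GradedRing.projZeroRingHom 𝒜).mapMatrix
    refine ⟨?_, hN0.isUnit_one_add, ?_⟩
    -- The determinant is unipotent with `k`-th power `1`, hence equals `1`.
    · refine MonoidHom.mem_ker.2 (Units.ext ?_)
      rw [AlgebraicK.K1.det_of_matrixClass hAx, Units.val_one]
      refine AlgebraicK.eq_one_of_isNilpotent_sub_one_of_pow_eq_one hkR
        (AlgebraicK.isNilpotent_det_one_add_sub_one hN) ?_
      rw [← AlgebraicK.K1.det_of_matrixClass hAx, ← Units.val_pow_eq_pow_val, ← map_pow, hpow,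
        map_one, Units.val_one]
    · have h := AlgebraicK.K1.coe_map (GradedRing.projZeroRingHom 𝒜) hAx
      rw [AlgebraicK.K1.map_projZero_eq_self 𝒜 hkR x hpow, hprojA,
        AlgebraicK.K1.matrixClass_ofMatrix _ hN0.isUnit_one_add] at h
      exact WithZero.coe_inj.1 h
  · have hx' : (x : AlgebraicK.K1 R) ^ k = 1 := by
      rw [← Subgroup.coe_pow, hx, Subgroup.coe_one]
    -- The projection factors through the local ring `𝒜 0`, so `x` is the image of a determinant one
    -- class of `K₁(𝒜 0)`, which is trivial.
    have hcomp : GradedRing.projZeroRingHom 𝒜 =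
        (algebraMap (𝒜 0) R).comp (GradedRing.projZeroRingHom' 𝒜) := rfl
    have hdet : AlgebraicK.K1.det R (x : AlgebraicK.K1 R) = 1 := MonoidHom.mem_ker.1 x.2
    refine Subtype.ext ?_
    rw [Subgroup.coe_one, ← AlgebraicK.K1.map_projZero_eq_self 𝒜 hkR _ hx', hcomp,
      ← AlgebraicK.K1.map_map, AlgebraicK.K1.eq_one_of_det_eq_one
        (AlgebraicK.K1.map (GradedRing.projZeroRingHom' 𝒜) _) (by
          rw [AlgebraicK.K1.det_map, hdet, map_one]), map_one]
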